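/- Let $M$ be a smooth $n$-dimensional manifold and let $\Pi^1(M,M)\rightrightarrows M$ be its groupoid of $1$-jets, i.e. the set of all linear isomorphisms $T_xM\to T_yM$ ($x,y\in M$), written $j^1_{x,y}\phi$ for local diffeomorphisms $\phi$ of $M$ with $\phi(x)=y$, with source $\alpha(j^1_{x,y}\phi)=x$, target $\beta(j^1_{x,y}\phi)=y$ and the smooth structure given by the local coordinates $(x^i,y^j,y^j_i)$, $y^j_i(j^1_{x,y}\phi)=\partial(y^j\circ\phi)/\partial x^i|_x$, for coordinate systems $(x^i)$ on $U$ and $(y^j)$ on $V$. Let $\Pi^1_G(M,M)$ be a reduced (Lie) subgroupoid of $\Pi^1(M,M)$, that is, a transitive subgroupoid over $M$ which is an embedded submanifold and whose source and target maps are submersions. For $U,V\subseteq M$ open put $\Pi^1_G(U,V)=\{g\in\Pi^1_G(M,M):\alpha(g)\in U,\ \beta(g)\in V\}$. Call $\Pi^1_G(M,M)$ integrable if there is a Lie subgroup $G$ of $Gl(n,\mathbb R)$ such that for all $x,y\in M$ there are local charts $\psi_U:U\to\overline U\subseteq\mathbb R^n$ and $\psi_V:V\to\overline V\subseteq\mathbb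 R^n$ with $x\in U$, $y\in V$ for which $$\Psi_{U,V}(j^1_{u,v}\phi)=\bigl(\psi_U(u),\ \psi_V(v),\ d(\psi_V\circ\phi\circ\psi_U^{-1})_{\psi_U(u)}\bigr)$$ is a diffeomorphism from $\Pi^1_G(U,V)$ onto $\overline U\times\overline V\times G$. Then $\Pi^1_G(M,M)$ is integrable if and only if for any two points $x,y\in M$ there exist coordinate systems $(x^i)$ on an open set $U\ni x$ and $(y^j)$ on an open set $V\ni y$ such that the local section $P(x^i,y^j)=(x^i,y^j,\delta^j_i)$ of $(\alpha,\beta)$, defined on $U\times V$ and written in the induced coordinates $(x^i,y^j,y^j_i)$ of $\Pi^1(M,M)$, takes values in $\Pi^1_G(M,M)$. -/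

import Mathlib

open Set Manifold
open scoped ContDiff Topology

noncomputable section

namespace JetGroupoid

/-! ### Submanifolds, submersions and diffeomorphisms between subsets of manifolds -/

section Submanifold

variable {F : Type*} [NormedAddCommGroup F] [NormedSpace ℝ F]
  {N : Type*} [TopologicalSpace N] [ChartedSpace F N]

/-- `c` is a smooth chart of `N` around `p` which straightens `S` onto the
`d`-dimensional linear subspace `W` of the model space. -/
structure IsSliceChart (d : ℕ) (S : Set N) (p : N) (c : OpenPartialHomeomorph N F)
    (W : Submodule ℝ F) : Prop where
  mem_maximalAtlas : c ∈ IsManifold.maximalAtlas 𝓘(ℝ, F) ∞ N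
  mem_source : p ∈ c.source
  finrank_eq : Module.finrank ℝ W = d
  image_eq : c '' (c.source ∩ S) = c.target ∩ (W : Set F)

variable (F) in
/-- `S` is a `d`-dimensional embedded smooth submanifold of `N`, a manifold modelled on `F`. -/
def IsEmbeddedSubmanifold (d : ℕ) (S : Set N) : Prop :=
  ∀ p ∈ S, ∃ (c : OpenPartialHomeomorph N F) (W : Submodule ℝ F), IsSliceChart d S p c W

variable (F) in
/-- The restriction to the `d`-dimensional embedded submanifold `S` of a map `f`, smooth on `N`, is
a submersion: in a slice chart around each point of `S`, the derivative of `f` maps the tangent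
space of `S` onto the tangent space of the target. -/
def IsSubmersionOn (E : Type*) [NormedAddCommGroup E] [NormedSpace ℝ E]
    {M : Type*} [TopologicalSpace M] [ChartedSpace E M] (d : ℕ) (f : N → M) (S : Set N) : Prop :=
  ∀ p ∈ S, ∃ (c : OpenPartialHomeomorph N F) (W : Submodule ℝ F), IsSliceChart d S p c W ∧
    ∀ v : TangentSpace 𝓘(ℝ, E) (f (c.symm (c p))), ∃ w ∈ W,
      mfderiv 𝓘(ℝ, F) 𝓘(ℝ, E) (f ∘ c.symm) (c p) w = v

end Submanifold

/-- `f` restricts to a diffeomorphism from `S` onto `T`: it is a bijection from `S` onto `T`, and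
it and its inverse are smooth. For embedded submanifolds `S` and `T`, this is a diffeomorphism
between them. -/
def IsDiffeoBetween {F H F' H' : Type*} [NormedAddCommGroup F] [NormedSpace ℝ F]
    [TopologicalSpace H] [NormedAddCommGroup F'] [NormedSpace ℝ F'] [TopologicalSpace H']
    (I : ModelWithCorners ℝ F H) (I' : ModelWithCorners ℝ F' H')
    {N N' : Type*} [TopologicalSpace N] [ChartedSpace H N] [TopologicalSpace N']
    [ChartedSpace H' N'] (f : N → N') (S : Set N) (T : Set N') : Prop :=
  BijOn f S T ∧ ContMDiffOn I I' ∞ f S ∧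
    ∃ g : N' → N, InvOn g f S T ∧ ContMDiffOn I' I ∞ g T

/-! ### The groupoid of 1-jets -/

/-- The space `ℝⁿ`. -/
abbrev R (n : ℕ) : Type := EuclideanSpace ℝ (Fin n)

/-- The general linear group `GL(n, ℝ)` of invertible endomorphisms of `ℝⁿ`, with Mathlib's
structure of a Lie group. -/
abbrev GLR (n : ℕ) : Type := (R n →L[ℝ] R n)ˣ

/-- The model space of the 1-jets groupoid, with coordinates `(xⁱ, yʲ, yʲᵢ)`. -/
abbrev JetModel (n : ℕ) : Type := R n × R n × (R n →L[ℝ] R n)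

variable {n : ℕ} {M : Type*} [TopologicalSpace M] [ChartedSpace (R n) M]

/-- A 1-jet `j¹_{x,y}φ` of a local diffeomorphism `φ` of `M` with `φ x = y`, given by its source
`x`, its target `y` and the linear isomorphism `T_xM → T_yM` which is the differential of `φ`
at `x`. -/
@[ext]
structure Jet (n : ℕ) (M : Type*) [TopologicalSpace M] [ChartedSpace (R n) M] where
  source : M
  target : M
  map : TangentSpace 𝓘(ℝ, R n) source ≃L[ℝ] TangentSpace 𝓘(ℝ, R n) target

namespace Jet

/-- The identity jet at `x`. -/
def unit (x : M) : Jet n M := ⟨x, x, ContinuousLinearEquiv.refl ℝ _⟩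

/-- The inverse of a jet. -/
def inv (g : Jet n M) : Jet n M := ⟨g.target, g.source, g.map.symm⟩

/-- The composition `g · h`, for `g` and `h` such that the source of `g` is the target of `h`. -/
def comp : (g h : Jet n M) → g.source = h.target → Jet n M
  | ⟨_, z, L⟩, ⟨x, _, K⟩, rfl => ⟨x, z, K.trans L⟩

end Jet

/-- Smooth charts of `M`. -/
abbrev smoothCharts (n : ℕ) (M : Type*) [TopologicalSpace M] [ChartedSpace (R n) M] :
    Set (OpenPartialHomeomorph M (R n)) :=
  IsManifold.maximalAtlas 𝓘(ℝ, R n) ∞ M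

/-- The differential at `x` of a chart `φ`, as a linear map `T_xM → ℝⁿ`. -/
def chartDifferential (φ : OpenPartialHomeomorph M (R n)) (x : M) :
    TangentSpace 𝓘(ℝ, R n) x →L[ℝ] R n :=
  mfderiv 𝓘(ℝ, R n) 𝓘(ℝ, R n) φ x

/-- Mathlib's identification of `T_xM` with the model space. -/
def tangentRefl (x : M) : TangentSpace 𝓘(ℝ, R n) x ≃L[ℝ] R n := ContinuousLinearEquiv.refl ℝ (R n)

open Classical in
/-- The differential at `x` of a smooth chart `φ` around `x`, as a linear isomorphism `T_xM → ℝⁿ`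
(with a junk value when the differential is not invertible). -/
def frame (φ : OpenPartialHomeomorph M (R n)) (x : M) : TangentSpace 𝓘(ℝ, R n) x ≃L[ℝ] R n :=
  if h : ∃ e : TangentSpace 𝓘(ℝ, R n) x ≃L[ℝ] R n,
      (e : TangentSpace 𝓘(ℝ, R n) x →L[ℝ] R n) = chartDifferential φ x then h.choose
  else tangentRefl x

/-- The linear isomorphism of `ℝⁿ` which represents a jet in the charts `φ` and `ψ`. For
`g = j¹_{x,y}f`, it is the jet at `(0, 0)` of `τ_{-ψ(y)} ∘ ψ ∘ f ∘ φ⁻¹ ∘ τ_{φ(x)}`. -/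
def linearPart (φ ψ : OpenPartialHomeomorph M (R n)) (g : Jet n M) : R n ≃L[ℝ] R n :=
  (frame φ g.source).symm.trans (g.map.trans (frame ψ g.target))

open Classical in
/-- A continuous linear isomorphism with underlying linear map `A`, if there is one. -/
def toEquiv (A : R n →L[ℝ] R n) : R n ≃L[ℝ] R n :=
  if h : A.IsInvertible then h.choose else ContinuousLinearEquiv.refl ℝ (R n)

theorem coe_toEquiv {A : R n →L[ℝ] R n} (h : A.IsInvertible) :
    (toEquiv A : R n →L[ℝ] R n) = A := by
  rw [toEquiv, dif_pos h]; exact h.choose_spec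

theorem toEquiv_coe (A : R n ≃L[ℝ] R n) : toEquiv (A : R n →L[ℝ] R n) = A :=
  ContinuousLinearEquiv.coe_injective
    (coe_toEquiv (ContinuousLinearMap.isInvertible_equiv (f := A)))

/-- The coordinates `(xⁱ, yʲ, yʲᵢ)` on the set of jets with source in the domain of `φ` and target
in the domain of `ψ`. -/
def jetPartialEquiv (φ ψ : OpenPartialHomeomorph M (R n)) :
    PartialEquiv (Jet n M) (JetModel n) where
  toFun g := (φ g.source, ψ g.target, (linearPart φ ψ g : R n →L[ℝ] R n))
  invFun p := ⟨φ.symm p.1, ψ.symm p.2.1,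
    (frame φ (φ.symm p.1)).trans ((toEquiv p.2.2).trans (frame ψ (ψ.symm p.2.1)).symm)⟩
  source := {g | g.source ∈ φ.source ∧ g.target ∈ ψ.source}
  target := {p | p.1 ∈ φ.target ∧ p.2.1 ∈ ψ.target ∧ p.2.2.IsInvertible}
  map_source' g hg := ⟨φ.map_source hg.1, ψ.map_source hg.2,
    ContinuousLinearMap.isInvertible_equiv (f := linearPart φ ψ g)⟩
  map_target' p hp := ⟨φ.map_target hp.1, ψ.map_target hp.2.1⟩
  left_inv' := by
    rintro ⟨x, y, L⟩ ⟨hx, hy⟩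
    have key : ∀ (x' y' : M), x' = x → y' = y →
        (⟨x', y', (frame φ x').trans ((linearPart φ ψ ⟨x, y, L⟩).trans (frame ψ y').symm)⟩ :
          Jet n M) = ⟨x, y, L⟩ := by
      rintro _ _ rfl rfl
      congr 1
      ext v
      simp [linearPart]
    simp only [toEquiv_coe]
    exact key _ _ (φ.left_inv hx) (ψ.left_inv hy)
  right_inv' := by
    rintro ⟨a, b, A⟩ ⟨ha, hb, hA⟩
    simp only [Prod.mk.injEq]
    refine ⟨φ.right_inv ha, ψ.right_inv hb, ?_⟩
    refine Eq.trans ?_ (coe_toEquiv hA)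
    congr 1
    ext v
    simp [linearPart]

theorem mdifferentiable_chart {φ : OpenPartialHomeomorph M (R n)} (hφ : φ ∈ smoothCharts n M) :
    φ.MDifferentiable 𝓘(ℝ, R n) 𝓘(ℝ, R n) :=
  ⟨(contMDiffOn_of_mem_maximalAtlas hφ).mdifferentiableOn (by simp),
    (contMDiffOn_symm_of_mem_maximalAtlas hφ).mdifferentiableOn (by simp)⟩

theorem coe_frame {φ : OpenPartialHomeomorph M (R n)} (hφ : φ ∈ smoothCharts n M) {x : M}
    (hx : x ∈ φ.source) :
    (frame φ x : TangentSpace 𝓘(ℝ, R n) x →L[ℝ] R n) = chartDifferential φ x := by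
  have h : ∃ e : TangentSpace 𝓘(ℝ, R n) x ≃L[ℝ] R n,
      (e : TangentSpace 𝓘(ℝ, R n) x →L[ℝ] R n) = chartDifferential φ x :=
    ⟨(mdifferentiable_chart hφ).mfderiv hx, rfl⟩
  rw [frame, dif_pos h]
  exact h.choose_spec

/-- The change of coordinates on a tangent space is the derivative of the change of charts. -/
theorem frame_symm_trans_frame {φ φ' : OpenPartialHomeomorph M (R n)}
    (hφ : φ ∈ smoothCharts n M) (hφ' : φ' ∈ smoothCharts n M) {x : M}
    (hx : x ∈ φ.source) (hx' : x ∈ φ'.source) (v : R n) :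
    frame φ' x ((frame φ x).symm v) = fderiv ℝ (φ' ∘ φ.symm) (φ x) v := by
  have hd := mdifferentiable_chart hφ
  have hd' := mdifferentiable_chart hφ'
  have h1 : mfderiv 𝓘(ℝ, R n) 𝓘(ℝ, R n) φ' x = (mfderiv 𝓘(ℝ, R n) 𝓘(ℝ, R n) (φ' ∘ φ.symm) (φ x)).comp
      (mfderiv 𝓘(ℝ, R n) 𝓘(ℝ, R n) φ x) := by
    have hx2 : φ.symm (φ x) ∈ φ'.source := by rwa [φ.left_inv hx]
    rw [← mfderiv_comp x ((hd'.mdifferentiableAt hx2).comp (φ x)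
      (hd.mdifferentiableAt_symm (φ.map_source hx))) (hd.mdifferentiableAt hx)]
    apply Filter.EventuallyEq.mfderiv_eq
    filter_upwards [φ.open_source.mem_nhds hx] with z hz
    simp [φ.left_inv hz]
  obtain ⟨w, rfl⟩ := (frame φ x).surjective v
  rw [ContinuousLinearEquiv.symm_apply_apply]
  have e1 := congrArg (fun A => A w) h1
  have e2 := congrArg (fun A => A w) (coe_frame hφ hx)
  have e3 := congrArg (fun A => A w) (coe_frame hφ' hx')
  rw [mfderiv_eq_fderiv] at e1
  exact e3.trans (e1.trans (congrArg (fderiv ℝ (φ' ∘ φ.symm) (φ x)) e2.symm))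

/-- The changes of coordinates on the set of jets are smooth maps on open sets. -/
theorem jetPartialEquiv_compatible {φ φ' ψ ψ' : OpenPartialHomeomorph M (R n)}
    (hφ : φ ∈ smoothCharts n M) (hφ' : φ' ∈ smoothCharts n M)
    (hψ : ψ ∈ smoothCharts n M) (hψ' : ψ' ∈ smoothCharts n M) :
    IsOpen ((jetPartialEquiv φ ψ).symm.trans (jetPartialEquiv φ' ψ')).source ∧
      ContDiffOn ℝ ∞ ((jetPartialEquiv φ ψ).symm.trans (jetPartialEquiv φ' ψ'))
        ((jetPartialEquiv φ ψ).symm.trans (jetPartialEquiv φ' ψ')).source := by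
  have hs : ((jetPartialEquiv φ ψ).symm.trans (jetPartialEquiv φ' ψ')).source =
      (φ.symm.trans φ').source ×ˢ ((ψ.symm.trans ψ').source ×ˢ
        range ((↑) : (R n ≃L[ℝ] R n) → (R n →L[ℝ] R n))) := by
    ext p
    simp only [jetPartialEquiv, PartialEquiv.trans_source, PartialEquiv.symm_source,
      OpenPartialHomeomorph.trans_source, OpenPartialHomeomorph.symm_source, mem_inter_iff,
      mem_ofPred_eq, mem_preimage, mem_prod, mem_range, PartialEquiv.coe_symm_mk,
      ContinuousLinearMap.IsInvertible]
    tauto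
  have hsm : ∀ {χ χ' : OpenPartialHomeomorph M (R n)}, χ ∈ smoothCharts n M →
      χ' ∈ smoothCharts n M → ContDiffOn ℝ ∞ (χ' ∘ χ.symm) (χ.symm.trans χ').source := by
    intro χ χ' h h'
    rw [← contMDiffOn_iff_contDiffOn]
    exact (contMDiffOn_of_mem_maximalAtlas h').comp
      ((contMDiffOn_symm_of_mem_maximalAtlas h).mono fun a ha => ha.1) fun a ha => ha.2
  have hsd : ∀ {χ χ' : OpenPartialHomeomorph M (R n)}, χ ∈ smoothCharts n M →
      χ' ∈ smoothCharts n M →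
      ContDiffOn ℝ ∞ (fderiv ℝ (χ' ∘ χ.symm)) (χ.symm.trans χ').source := by
    intro χ χ' h h'
    exact (hsm h h').fderiv_of_isOpen (χ.symm.trans χ').open_source (by simp)
  refine ⟨?_, ?_⟩
  · rw [hs]
    exact (φ.symm.trans φ').open_source.prod
      ((ψ.symm.trans ψ').open_source.prod ContinuousLinearEquiv.isOpen)
  have h1 : ContDiffOn ℝ ∞ (fun p : JetModel n => (φ' ∘ φ.symm) p.1)
      ((jetPartialEquiv φ ψ).symm.trans (jetPartialEquiv φ' ψ')).source :=
    (hsm hφ hφ').comp contDiffOn_fst fun p hp => by rw [hs] at hp; exact hp.1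
  have h2 : ContDiffOn ℝ ∞ (fun p : JetModel n => p.2.1)
      ((jetPartialEquiv φ ψ).symm.trans (jetPartialEquiv φ' ψ')).source :=
    (contDiff_fst.comp contDiff_snd).contDiffOn
  have h3 : ContDiffOn ℝ ∞ (fun p : JetModel n => p.2.2)
      ((jetPartialEquiv φ ψ).symm.trans (jetPartialEquiv φ' ψ')).source :=
    (contDiff_snd.comp contDiff_snd).contDiffOn
  have h4 : ContDiffOn ℝ ∞ (fun p : JetModel n => (ψ' ∘ ψ.symm) p.2.1)
      ((jetPartialEquiv φ ψ).symm.trans (jetPartialEquiv φ' ψ')).source :=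
    (hsm hψ hψ').comp h2 fun p hp => by rw [hs] at hp; exact hp.2.1
  have h5 : ContDiffOn ℝ ∞ (fun p : JetModel n => fderiv ℝ (ψ' ∘ ψ.symm) p.2.1)
      ((jetPartialEquiv φ ψ).symm.trans (jetPartialEquiv φ' ψ')).source :=
    (hsd hψ hψ').comp h2 fun p hp => by rw [hs] at hp; exact hp.2.1
  have h6 : ContDiffOn ℝ ∞ (fun p : JetModel n => fderiv ℝ (φ ∘ φ'.symm) ((φ' ∘ φ.symm) p.1))
      ((jetPartialEquiv φ ψ).symm.trans (jetPartialEquiv φ' ψ')).source :=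
    (hsd hφ' hφ).comp h1 fun p hp => by
      rw [hs] at hp
      exact (φ.symm.trans φ').map_source hp.1
  refine (h1.prodMk (h4.prodMk (h5.clm_comp (h3.clm_comp h6)))).congr ?_
  rintro ⟨a, b, A⟩ hp
  rw [hs] at hp
  obtain ⟨⟨ha, ha'⟩, ⟨hb, hb'⟩, hA⟩ := hp
  refine Prod.ext rfl (Prod.ext rfl ?_)
  ext1 v
  have e1 := frame_symm_trans_frame hφ' hφ ha' (φ.map_target ha) v
  have e2 := frame_symm_trans_frame hψ hψ' (ψ.map_target hb) hb'
  have e3 := coe_toEquiv hA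
  have e4 : ∀ w, toEquiv A w = A w := fun w => congrArg (fun B => B w) e3
  have e5 : ψ (ψ.symm b) = b := ψ.right_inv hb
  rw [e5] at e2
  change frame ψ' (ψ.symm b) ((frame ψ (ψ.symm b)).symm (toEquiv A
    (frame φ (φ.symm a) ((frame φ' (φ.symm a)).symm v)))) = _
  rw [e2, e4]
  exact congrArg (fun w => fderiv ℝ (ψ' ∘ ψ.symm) b (A w)) e1

variable [IsManifold 𝓘(ℝ, R n) ∞ M]

variable (n M) in
/-- The charts `(xⁱ, yʲ, yʲᵢ)` of the groupoid of 1-jets, for all smooth charts `(xⁱ)` and `(yʲ)`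
of `M`. -/
def jetCore : ChartedSpaceCore (JetModel n) (Jet n M) where
  atlas := {e | ∃ φ ∈ smoothCharts n M, ∃ ψ ∈ smoothCharts n M, e = jetPartialEquiv φ ψ}
  chartAt g := jetPartialEquiv (chartAt (R n) g.source) (chartAt (R n) g.target)
  mem_chart_source g := ⟨mem_chart_source _ _, mem_chart_source _ _⟩
  chart_mem_atlas g := ⟨_, IsManifold.chart_mem_maximalAtlas _, _,
    IsManifold.chart_mem_maximalAtlas _, rfl⟩
  open_source := by
    rintro _ _ ⟨φ, hφ, ψ, hψ, rfl⟩ ⟨φ', hφ', ψ', hψ', rfl⟩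
    exact (jetPartialEquiv_compatible hφ hφ' hψ hψ').1
  continuousOn_toFun := by
    rintro _ _ ⟨φ, hφ, ψ, hψ, rfl⟩ ⟨φ', hφ', ψ', hψ', rfl⟩
    exact (jetPartialEquiv_compatible hφ hφ' hψ hψ').2.continuousOn

instance : TopologicalSpace (Jet n M) := (jetCore n M).toTopologicalSpace

instance : ChartedSpace (JetModel n) (Jet n M) := (jetCore n M).toChartedSpace

/-- The chart `(xⁱ, yʲ, yʲᵢ)` of the groupoid of 1-jets induced by the smooth charts `φ = (xⁱ)` and
`ψ = (yʲ)`, with domain `Π¹(U, V)` where `U` and `V` are the domains of `φ` and `ψ`. -/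
def jetChart (φ ψ : OpenPartialHomeomorph M (R n)) (hφ : φ ∈ smoothCharts n M)
    (hψ : ψ ∈ smoothCharts n M) : OpenPartialHomeomorph (Jet n M) (JetModel n) :=
  (jetCore n M).openPartialHomeomorph (jetPartialEquiv φ ψ) ⟨φ, hφ, ψ, hψ, rfl⟩

theorem jetChart_mem_atlas {φ ψ : OpenPartialHomeomorph M (R n)} (hφ : φ ∈ smoothCharts n M)
    (hψ : ψ ∈ smoothCharts n M) : jetChart φ ψ hφ hψ ∈ atlas (JetModel n) (Jet n M) :=
  mem_iUnion₂.2 ⟨_, ⟨φ, hφ, ψ, hψ, rfl⟩, rfl⟩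

instance : IsManifold 𝓘(ℝ, JetModel n) ∞ (Jet n M) := by
  refine isManifold_of_contDiffOn _ _ _ ?_
  rintro e e' he he'
  obtain ⟨_, ⟨φ, hφ, ψ, hψ, rfl⟩, rfl⟩ := mem_iUnion₂.1 he
  obtain ⟨_, ⟨φ', hφ', ψ', hψ', rfl⟩, rfl⟩ := mem_iUnion₂.1 he'
  have := (jetPartialEquiv_compatible hφ hφ' hψ hψ').2
  simp only [modelWithCornersSelf_coe, modelWithCornersSelf_coe_symm, Function.comp_id,
    Function.id_comp, preimage_id, range_id, inter_univ]
  exact this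

/-! ### Reduced subgroupoids and integrability -/

/-- A reduced Lie subgroupoid of the groupoid `Π¹(M, M)` of 1-jets: a transitive subgroupoid with
the same base `M` which is an embedded submanifold, and whose source and target maps are
submersions. (The structure maps are restrictions of smooth maps to embedded submanifolds, so they
are smooth.) -/
structure IsReducedSubgroupoid (Γ : Set (Jet n M)) : Prop where
  unit_mem : ∀ x : M, Jet.unit x ∈ Γ
  inv_mem : ∀ g ∈ Γ, g.inv ∈ Γ
  comp_mem : ∀ g ∈ Γ, ∀ h ∈ Γ, ∀ hgh : g.source = h.target, g.comp h hgh ∈ Γ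
  transitive : ∀ x y : M, ∃ g ∈ Γ, g.source = x ∧ g.target = y
  submanifold : ∃ d : ℕ, IsEmbeddedSubmanifold (JetModel n) d Γ ∧
    IsSubmersionOn (JetModel n) (R n) d Jet.source Γ ∧ IsSubmersionOn (JetModel n) (R n) d Jet.target Γ

/-- `G` is a Lie subgroup of `GL(n, ℝ)`: a subgroup which is an embedded submanifold. (A subgroup
`G` for which an embedded submanifold of the 1-jets is locally diffeomorphic to `ℝⁿ × ℝⁿ × G` is
always embedded.) -/
def IsLieSubgroup (G : Subgroup (GLR n)) : Prop :=
  ∃ d : ℕ, IsEmbeddedSubmanifold (R n →L[ℝ] R n) d (G : Set (GLR n))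

/-- The subset `Π¹_G(U, V)` of the jets in `Γ` with source in `U` and target in `V`. -/
def restrict (Γ : Set (Jet n M)) (U V : Set M) : Set (Jet n M) :=
  {g ∈ Γ | g.source ∈ U ∧ g.target ∈ V}

/-- The map `Ψ_{U,V} = (ψ_U ∘ α, ψ_V ∘ β, Ψ̄_{U,V})` on jets, with values in `ℝⁿ × ℝⁿ × GL(n, ℝ)`,
induced by the charts `φ = ψ_U` and `ψ = ψ_V`. -/
def inducedMap (φ ψ : OpenPartialHomeomorph M (R n)) (g : Jet n M) : R n × R n × GLR n :=
  (φ g.source, ψ g.target, (linearPart φ ψ g).toUnit)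

/-- `Γ` is integrable: for some Lie subgroup `G` of `GL(n, ℝ)`, it is locally diffeomorphic to the
groupoid `ℝⁿ × ℝⁿ × G`, through diffeomorphisms induced by charts of `M`. -/
def IsIntegrable (Γ : Set (Jet n M)) : Prop :=
  ∃ G : Subgroup (GLR n), IsLieSubgroup G ∧ ∀ x y : M,
    ∃ φ ∈ smoothCharts n M, ∃ ψ ∈ smoothCharts n M, x ∈ φ.source ∧ y ∈ ψ.source ∧
      IsDiffeoBetween 𝓘(ℝ, JetModel n)
        (𝓘(ℝ, R n).prod (𝓘(ℝ, R n).prod 𝓘(ℝ, R n →L[ℝ] R n)))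
        (inducedMap φ ψ) (restrict Γ φ.source ψ.source)
        (φ.target ×ˢ (ψ.target ×ˢ (G : Set (GLR n))))

/-- The local section `P(xⁱ, yʲ) = (xⁱ, yʲ, δʲᵢ)` of `(α, β)`, in the coordinates given by the charts
`φ = (xⁱ)` and `ψ = (yʲ)`; it is meaningful for `a` and `b` in the targets of `φ` and `ψ`. -/
def coordinateSection (φ ψ : OpenPartialHomeomorph M (R n)) (hφ : φ ∈ smoothCharts n M)
    (hψ : ψ ∈ smoothCharts n M) (a b : R n) : Jet n M :=
  (jetChart φ ψ hφ hψ).symm (a, b, ContinuousLinearMap.id ℝ (R n))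

theorem source_coordinateSection (φ ψ : OpenPartialHomeomorph M (R n)) (hφ : φ ∈ smoothCharts n M)
    (hψ : ψ ∈ smoothCharts n M) (a b : R n) :
    (coordinateSection φ ψ hφ hψ a b).source = φ.symm a := rfl

theorem target_coordinateSection (φ ψ : OpenPartialHomeomorph M (R n)) (hφ : φ ∈ smoothCharts n M)
    (hψ : ψ ∈ smoothCharts n M) (a b : R n) :
    (coordinateSection φ ψ hφ hψ a b).target = ψ.symm b := rfl

end JetGroupoid

end

noncomputable section

/-! ### Straightening the image of a smooth local retraction -/

section Retraction

variable {F : Type*} [NormedAddCommGroup F] [NormedSpace ℝ F]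

/-! In the coordinates `(xⁱ, yʲ, yʲᵢ)` both conditions concern jets represented by matrices. If `Γ`
is integrable, the jet sent to `(a, b, 1)` by `inducedMap` lies in `Γ`, and it is the value of the
section at `(a, b)`.

Conversely, suppose that `Γ` contains the jets with identity matrix in charts `φ`, `ψ`. Composing
with them carries any jet over these charts to a loop at a fixed point `x` without changing its
matrix, so membership in `Γ` means that the matrix lies in the isotropy group at `x`, read in the
frame of `φ` (`ContainsSection.mem_iff`). Thus `Γ` is locally a product. To get one group for all
pairs of points, fix a base point `z`, join it to `x` by some jet `T` in `Γ`, and change both charts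
by the same linear map, so that the frame at `x` becomes the frame at `z` transported by `T`
(`isotropyGroup_transport`, `ContainsSection.linearChange`).

It remains to see that the isotropy group is embedded. A slice chart of `Γ` yields a smooth local
retraction of the endomorphisms onto the group near `1`; the image of a smooth retraction is a
submanifold (`exists_straightening_of_retraction`), and left translations spread the chart over the
group. -/

theorem OpenPartialHomeomorph.mem_contDiffGroupoid_of_contDiffOn {f : OpenPartialHomeomorph F F}
    (h : ContDiffOn ℝ ∞ f f.source) (h' : ContDiffOn ℝ ∞ f.symm f.target) :
    f ∈ contDiffGroupoid ∞ 𝓘(ℝ, F) := by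
  rw [contDiffGroupoid, mem_groupoid_of_pregroupoid]
  simp only [contDiffPregroupoid, modelWithCornersSelf_coe,
    modelWithCornersSelf_coe_symm, Function.comp_id, Function.id_comp, preimage_id, range_id,
    inter_univ]
  exact ⟨h, h'⟩

/-- A smooth local retraction of `F` onto a subset `S` near `s ∈ S` can be straightened: there is a
local diffeomorphism around `s` which maps `S` onto a linear subspace. -/
theorem exists_straightening_of_retraction [CompleteSpace F] {S N : Set F} {s : F} {r : F → F}
    (hN : IsOpen N) (hsN : s ∈ N) (hsS : s ∈ S) (hr : ContDiffOn ℝ ∞ r N)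
    (hrS : ∀ f ∈ N, r f ∈ S) (hrf : ∀ f ∈ N, f ∈ S → r f = f) :
    ∃ (c : OpenPartialHomeomorph F F) (W : Submodule ℝ F), c ∈ contDiffGroupoid ∞ 𝓘(ℝ, F) ∧
      s ∈ c.source ∧ c '' (c.source ∩ S) = c.target ∩ (W : Set F) := by
  have hrs : r s = s := hrf s hsN hsS
  have hrat : ContDiffAt ℝ ∞ r s := hr.contDiffAt (hN.mem_nhds hsN)
  have hstrict : HasStrictFDerivAt r (fderiv ℝ r s) s := hrat.hasStrictFDerivAt (by simp)
  set D : F →L[ℝ] F := fderiv ℝ r s with hD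
  -- Near `s` one has `r ∘ r = r`, so the chain rule makes `D` idempotent.
  have hDD : D.comp D = D := by
    have h1 : HasFDerivAt (r ∘ r) (D.comp D) s := by
      refine HasFDerivAt.comp s ?_ hstrict.hasFDerivAt
      rw [hrs]
      exact hstrict.hasFDerivAt
    have h2 : HasFDerivAt (r ∘ r) D s := by
      refine hstrict.hasFDerivAt.congr_of_eventuallyEq ?_
      have h3 : r ⁻¹' N ∈ 𝓝 s := hrat.continuousAt (by rw [hrs]; exact hN.mem_nhds hsN)
      filter_upwards [hN.mem_nhds hsN, h3] with f hf hf'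
      exact hrf _ hf' (hrS f hf)
    exact h1.unique h2
  have hDDv : ∀ v, D (D v) = D v := fun v => congrArg (fun A : F →L[ℝ] F => A v) hDD
  -- The derivative of `Φ` at `s` is `D² + (1 - D)² = 1`, and on `S` the second summand vanishes, so
  -- `Φ` maps `S` into the range of `D`.
  set Φ : F → F := fun f => D (r f - s) + ((f - r f) - D (f - r f)) with hΦ
  have hΦN : ContDiffOn ℝ ∞ Φ N := by
    refine (D.contDiff.comp_contDiffOn (hr.sub contDiffOn_const)).add ?_
    exact (contDiffOn_id.sub hr).sub (D.contDiff.comp_contDiffOn (contDiffOn_id.sub hr))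
  have hΦ' : HasStrictFDerivAt Φ ((ContinuousLinearEquiv.refl ℝ F : F ≃L[ℝ] F) : F →L[ℝ] F) s := by
    have h1 := (D.hasStrictFDerivAt.comp s (hstrict.sub_const s)).add
      (((hasStrictFDerivAt_id s).sub hstrict).sub
        (D.hasStrictFDerivAt.comp s ((hasStrictFDerivAt_id s).sub hstrict)))
    refine h1.congr_fderiv ?_
    ext v
    simp [hDDv]
  set e := hΦ'.toOpenPartialHomeomorph Φ with he
  have hec : ∀ f, e f = Φ f := fun f => rfl
  have hse : s ∈ e.source := hΦ'.mem_toOpenPartialHomeomorph_source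
  -- Two shrinkings: `r f` must stay where `e` is injective, and the derivative of `Φ` must stay
  -- invertible so that the inverse is smooth on the whole target.
  have hO1 : IsOpen (N ∩ r ⁻¹' (e.source ∩ N)) :=
    hr.continuousOn.isOpen_inter_preimage hN (e.open_source.inter hN)
  have hO2 : IsOpen (N ∩ fderiv ℝ Φ ⁻¹' range ((↑) : (F ≃L[ℝ] F) → (F →L[ℝ] F))) :=
    (hΦN.continuousOn_fderiv_of_isOpen hN (by simp)).isOpen_inter_preimage hN
      ContinuousLinearEquiv.isOpen
  have hO3 := hO1.inter hO2
  set O := (N ∩ r ⁻¹' (e.source ∩ N)) ∩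
    (N ∩ fderiv ℝ Φ ⁻¹' range ((↑) : (F ≃L[ℝ] F) → (F →L[ℝ] F))) with hO
  have hsO : s ∈ O := by
    refine ⟨⟨hsN, ?_⟩, hsN, ?_⟩
    · rw [mem_preimage, hrs]
      exact ⟨hse, hsN⟩
    · exact ⟨_, hΦ'.hasFDerivAt.fderiv.symm⟩
  set c := e.restrOpen O hO3 with hc
  have hcs : c.source = e.source ∩ O := e.restrOpen_source O hO3
  refine ⟨c, D.range, OpenPartialHomeomorph.mem_contDiffGroupoid_of_contDiffOn ?_ ?_, ?_, ?_⟩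
  · exact hΦN.mono fun f hf => by rw [hcs] at hf; exact hf.2.1.1
  · intro y hy
    have hy' : c.symm y ∈ c.source := c.map_target hy
    rw [hcs] at hy'
    obtain ⟨L, hL⟩ := hy'.2.2.2
    have hat : ContDiffAt ℝ ∞ Φ (c.symm y) := hΦN.contDiffAt (hN.mem_nhds hy'.2.1.1)
    refine (c.contDiffAt_symm (f₀' := L) hy ?_ hat).contDiffWithinAt
    rw [hL]
    exact (hat.differentiableAt (by simp)).hasFDerivAt
  · rw [hcs]
    exact ⟨hse, hsO⟩
  · have hΦS : ∀ f ∈ N, f ∈ S → Φ f = D (f - s) := by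
      intro f hf hfS
      simp [hΦ, hrf f hf hfS]
    ext y
    constructor
    · rintro ⟨f, ⟨hf, hfS⟩, rfl⟩
      refine ⟨c.map_source hf, f - s, ?_⟩
      rw [hcs] at hf
      exact (hΦS f hf.2.1.1 hfS).symm
    · rintro ⟨hy, v, hv⟩
      have hf : c.symm y ∈ c.source := c.map_target hy
      have hfy : Φ (c.symm y) = y := c.right_inv hy
      refine ⟨c.symm y, ⟨hf, ?_⟩, c.right_inv hy⟩
      rw [hcs] at hf
      set f := c.symm y with hf_def
      have hfN : f ∈ N := hf.2.1.1
      have hDy : D y = y := by rw [← hv]; exact hDDv v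
      have hDΦ : D (Φ f) = D (r f - s) := by
        simp only [hΦ, map_add, map_sub, hDDv]
        abel
      have hrS' : r f ∈ S := hrS f hfN
      -- If `Φ f` lies in the range of `D`, then `Φ (r f) = D (r f - s) = D (Φ f) = Φ f`, and
      -- injectivity forces `f = r f ∈ S`.
      have hinj : r f = f := by
        refine e.injOn hf.2.1.2.1 hf.1 ?_
        rw [hec, hec, hΦS _ hf.2.1.2.2 hrS', ← hDΦ, hfy, hDy]
      rw [← hinj]
      exact hrS'

end Retraction

/-! ### Charts composed with smooth changes of coordinates -/

theorem StructureGroupoid.trans_mem_maximalAtlas {H M : Type*} [TopologicalSpace H]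
    [TopologicalSpace M] [ChartedSpace H M] {𝒢 : StructureGroupoid H}
    {c : OpenPartialHomeomorph M H} {k : OpenPartialHomeomorph H H} (hc : c ∈ 𝒢.maximalAtlas M)
    (hk : k ∈ 𝒢) : c.trans k ∈ 𝒢.maximalAtlas M := by
  intro c' hc'
  refine ⟨?_, ?_⟩
  · rw [OpenPartialHomeomorph.trans_symm_eq_symm_trans_symm, OpenPartialHomeomorph.trans_assoc]
    exact 𝒢.trans (𝒢.symm hk) (hc c' hc').1
  · rw [← OpenPartialHomeomorph.trans_assoc]
    exact 𝒢.trans (hc c' hc').2 hk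

theorem ContinuousLinearEquiv.mem_contDiffGroupoid {F : Type*} [NormedAddCommGroup F]
    [NormedSpace ℝ F] (L : F ≃L[ℝ] F) :
    L.toHomeomorph.toOpenPartialHomeomorph ∈ contDiffGroupoid ∞ 𝓘(ℝ, F) :=
  OpenPartialHomeomorph.mem_contDiffGroupoid_of_contDiffOn L.contDiff.contDiffOn
    L.symm.contDiff.contDiffOn

namespace JetGroupoid

/-! ### Linear changes of charts -/

section LinearChange

variable {n : ℕ} {M : Type*} [TopologicalSpace M]

/-- The chart obtained from `φ` by a linear change of coordinates. -/
def linearChange (φ : OpenPartialHomeomorph M (R n)) (C : R n ≃L[ℝ] R n) :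
    OpenPartialHomeomorph M (R n) :=
  φ.trans C.toHomeomorph.toOpenPartialHomeomorph

theorem linearChange_source (φ : OpenPartialHomeomorph M (R n)) (C : R n ≃L[ℝ] R n) :
    (linearChange φ C).source = φ.source := by
  simp [linearChange]

end LinearChange

variable {n : ℕ} {M : Type*} [TopologicalSpace M] [ChartedSpace (R n) M]

theorem linearChange_mem {φ : OpenPartialHomeomorph M (R n)} (hφ : φ ∈ smoothCharts n M)
    (C : R n ≃L[ℝ] R n) : linearChange φ C ∈ smoothCharts n M :=
  StructureGroupoid.trans_mem_maximalAtlas hφ C.mem_contDiffGroupoid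

theorem frame_linearChange {φ : OpenPartialHomeomorph M (R n)} (hφ : φ ∈ smoothCharts n M)
    (C : R n ≃L[ℝ] R n) {x : M} (hx : x ∈ φ.source) :
    frame (linearChange φ C) x = (frame φ x).trans C := by
  ext1
  funext w
  obtain ⟨v, rfl⟩ := (frame φ x).symm.surjective w
  rw [frame_symm_trans_frame hφ (linearChange_mem hφ C) hx
    (by rwa [linearChange_source])]
  have h : (linearChange φ C ∘ φ.symm) =ᶠ[𝓝 (φ x)] C := by
    filter_upwards [φ.open_target.mem_nhds (φ.map_source hx)] with a ha
    exact congrArg C (φ.right_inv ha)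
  rw [h.fderiv_eq, C.fderiv]
  simp

/-! ### Subgroupoids containing the coordinate sections of a pair of charts -/

variable {Γ : Set (Jet n M)}

/-- `Γ` contains the jets which are represented by the identity in the charts `φ` and `ψ`. -/
def ContainsSection (Γ : Set (Jet n M)) (φ ψ : OpenPartialHomeomorph M (R n)) : Prop :=
  ∀ u ∈ φ.source, ∀ v ∈ ψ.source, (⟨u, v, (frame φ u).trans (frame ψ v).symm⟩ : Jet n M) ∈ Γ

/-- The same `C` acts at source and target, so it cancels in `C⁻¹ ∘ C` and the jets are unchanged.
-/
theorem ContainsSection.linearChange {φ ψ : OpenPartialHomeomorph M (R n)}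
    (h : ContainsSection Γ φ ψ) (hφ : φ ∈ smoothCharts n M) (hψ : ψ ∈ smoothCharts n M)
    (C : R n ≃L[ℝ] R n) : ContainsSection Γ (linearChange φ C) (linearChange ψ C) := by
  intro u hu v hv
  rw [linearChange_source] at hu hv
  rw [frame_linearChange hφ C hu, frame_linearChange hψ C hv]
  convert h u hu v hv using 2
  ext w
  simp

variable [IsManifold 𝓘(ℝ, R n) ∞ M]

theorem IsReducedSubgroupoid.trans_mem (hΓ : IsReducedSubgroupoid Γ) {x y z : M}
    {K : TangentSpace 𝓘(ℝ, R n) x ≃L[ℝ] TangentSpace 𝓘(ℝ, R n) y}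
    {L : TangentSpace 𝓘(ℝ, R n) y ≃L[ℝ] TangentSpace 𝓘(ℝ, R n) z}
    (hK : (⟨x, y, K⟩ : Jet n M) ∈ Γ) (hL : (⟨y, z, L⟩ : Jet n M) ∈ Γ) :
    (⟨x, z, K.trans L⟩ : Jet n M) ∈ Γ :=
  hΓ.comp_mem _ hL _ hK rfl

theorem IsReducedSubgroupoid.symm_mem (hΓ : IsReducedSubgroupoid Γ) {x y : M}
    {K : TangentSpace 𝓘(ℝ, R n) x ≃L[ℝ] TangentSpace 𝓘(ℝ, R n) y}
    (hK : (⟨x, y, K⟩ : Jet n M) ∈ Γ) : (⟨y, x, K.symm⟩ : Jet n M) ∈ Γ :=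
  hΓ.inv_mem _ hK

theorem coordinateSection_eq {φ ψ : OpenPartialHomeomorph M (R n)} (hφ : φ ∈ smoothCharts n M)
    (hψ : ψ ∈ smoothCharts n M) (a b : R n) :
    coordinateSection φ ψ hφ hψ a b =
      ⟨φ.symm a, ψ.symm b, (frame φ (φ.symm a)).trans (frame ψ (ψ.symm b)).symm⟩ := by
  have h : toEquiv (ContinuousLinearMap.id ℝ (R n)) = ContinuousLinearEquiv.refl ℝ (R n) :=
    toEquiv_coe (ContinuousLinearEquiv.refl ℝ (R n))
  change (⟨φ.symm a, ψ.symm b, (frame φ (φ.symm a)).trans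
    ((toEquiv (ContinuousLinearMap.id ℝ (R n))).trans (frame ψ (ψ.symm b)).symm)⟩ : Jet n M) = _
  rw [h]
  rfl

theorem containsSection_iff {φ ψ : OpenPartialHomeomorph M (R n)} (hφ : φ ∈ smoothCharts n M)
    (hψ : ψ ∈ smoothCharts n M) : ContainsSection Γ φ ψ ↔
      ∀ a ∈ φ.target, ∀ b ∈ ψ.target, coordinateSection φ ψ hφ hψ a b ∈ Γ := by
  constructor
  · intro h a ha b hb
    rw [coordinateSection_eq]
    exact h _ (φ.map_target ha) _ (ψ.map_target hb)
  · intro h u hu v hv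
    have := h _ (φ.map_source hu) _ (ψ.map_source hv)
    rwa [coordinateSection_eq, φ.left_inv hu, ψ.left_inv hv] at this

/-- The group of the matrices, in the frame `e`, of the jets in `Γ` from `x` to itself. -/
def isotropyGroup (hΓ : IsReducedSubgroupoid Γ) (x : M)
    (e : TangentSpace 𝓘(ℝ, R n) x ≃L[ℝ] R n) : Subgroup (GLR n) where
  carrier := {A | (⟨x, x, e.trans ((ContinuousLinearEquiv.ofUnit A).trans e.symm)⟩ : Jet n M) ∈ Γ}
  one_mem' := by
    change (⟨x, x, e.trans ((ContinuousLinearEquiv.ofUnit 1).trans e.symm)⟩ : Jet n M) ∈ Γ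
    convert hΓ.unit_mem x using 1
    rw [Jet.unit]
    congr 1
    ext w
    exact e.symm_apply_apply w
  mul_mem' {A B} hA hB := by
    change (⟨x, x, e.trans ((ContinuousLinearEquiv.ofUnit (A * B)).trans e.symm)⟩ : Jet n M) ∈ Γ
    convert hΓ.trans_mem hB hA using 2
    ext w
    change e.symm (A.1 (B.1 (e w))) = e.symm (A.1 (e (e.symm (B.1 (e w)))))
    rw [e.apply_symm_apply]
  inv_mem' {A} hA := hΓ.symm_mem hA

theorem mem_isotropyGroup {hΓ : IsReducedSubgroupoid Γ} {x : M}
    {e : TangentSpace 𝓘(ℝ, R n) x ≃L[ℝ] R n} {A : GLR n} : A ∈ isotropyGroup hΓ x e ↔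
      (⟨x, x, e.trans ((ContinuousLinearEquiv.ofUnit A).trans e.symm)⟩ : Jet n M) ∈ Γ :=
  Iff.rfl

/-- Conjugation by `T` identifies the loops at `x` with those at `y`; transporting the frame by the
same `T` keeps their matrices equal. -/
theorem isotropyGroup_transport (hΓ : IsReducedSubgroupoid Γ) {x y : M}
    {T : TangentSpace 𝓘(ℝ, R n) x ≃L[ℝ] TangentSpace 𝓘(ℝ, R n) y}
    (hT : (⟨x, y, T⟩ : Jet n M) ∈ Γ) (e : TangentSpace 𝓘(ℝ, R n) x ≃L[ℝ] R n) :
    isotropyGroup hΓ y (T.symm.trans e) = isotropyGroup hΓ x e := by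
  ext A
  rw [mem_isotropyGroup, mem_isotropyGroup]
  constructor
  · intro h
    convert hΓ.trans_mem (hΓ.trans_mem hT h) (hΓ.symm_mem hT) using 2
    ext w
    simp
  · intro h
    convert hΓ.trans_mem (hΓ.trans_mem (hΓ.symm_mem hT) h) hT using 2
    rfl

theorem ContainsSection.mem_iff (hΓ : IsReducedSubgroupoid Γ)
    {φ ψ : OpenPartialHomeomorph M (R n)} (h : ContainsSection Γ φ ψ) {x : M} (hx : x ∈ φ.source)
    {g : Jet n M} (hg : g.source ∈ φ.source) (hg' : g.target ∈ ψ.source) :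
    g ∈ Γ ↔ (linearPart φ ψ g).toUnit ∈ isotropyGroup hΓ x (frame φ x) := by
  obtain ⟨u, v, L⟩ := g
  have h1 := h u hg v hg'
  have h2 := h x hx v hg'
  rw [mem_isotropyGroup]
  constructor
  · intro hL
    -- The loop `x → v → u → v → x`: the sections only join `φ.source` to `ψ.source`, so `u` is
    -- reached from `x` through `v`. Every factor but `L` has identity matrix.
    convert hΓ.trans_mem (hΓ.trans_mem (hΓ.trans_mem h2 (hΓ.symm_mem h1)) hL) (hΓ.symm_mem h2)
      using 2
    ext w
    change (frame φ x).symm (frame ψ v (L ((frame φ u).symm (frame φ x w)))) =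
      (frame φ x).symm (frame ψ v (L ((frame φ u).symm (frame ψ v ((frame ψ v).symm
        (frame φ x w))))))
    rw [ContinuousLinearEquiv.apply_symm_apply]
  · intro hL
    -- The path `u → v → x → x → v`, with the given loop at `x` in the middle.
    convert hΓ.trans_mem (hΓ.trans_mem (hΓ.trans_mem h1 (hΓ.symm_mem h2)) hL) h2 using 2
    ext w
    change L w = (frame ψ v).symm (frame φ x ((frame φ x).symm (frame ψ v (L ((frame φ u).symm
      (frame φ x ((frame φ x).symm (frame ψ v ((frame ψ v).symm (frame φ u w))))))))))
    simp

/-! ### Lie subgroups of the general linear group -/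

/-- Left multiplication by an invertible endomorphism. -/
def leftMul (g : GLR n) : (R n →L[ℝ] R n) ≃L[ℝ] (R n →L[ℝ] R n) :=
  ContinuousLinearEquiv.equivOfInverse (ContinuousLinearMap.compL ℝ (R n) (R n) (R n) g)
    (ContinuousLinearMap.compL ℝ (R n) (R n) (R n) (g⁻¹ : GLR n))
    (fun A => Units.inv_mul_cancel_left g A) (fun A => Units.mul_inv_cancel_left g A)

/-- A subgroup of the general linear group which can be straightened around the identity is a Lie
subgroup. -/
theorem isLieSubgroup_of_straightening {G : Subgroup (GLR n)}
    {c : OpenPartialHomeomorph (R n →L[ℝ] R n) (R n →L[ℝ] R n)}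
    {W : Submodule ℝ (R n →L[ℝ] R n)} (hc : c ∈ contDiffGroupoid ∞ 𝓘(ℝ, R n →L[ℝ] R n))
    (h1 : 1 ∈ c.source)
    (himg : c '' (c.source ∩ (Units.val '' (G : Set (GLR n)))) = c.target ∩ (W : Set _)) :
    IsLieSubgroup G := by
  refine ⟨Module.finrank ℝ W, fun g hg => ?_⟩
  let k := (leftMul g⁻¹).toHomeomorph.toOpenPartialHomeomorph.trans c
  -- The chart of `GLR n` is the inclusion into endomorphisms; translating by `g⁻¹` moves `g` to
  -- `1`, where `c` applies.
  let e := (chartAt (R n →L[ℝ] R n) g).trans k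
  have hk : k ∈ contDiffGroupoid ∞ 𝓘(ℝ, R n →L[ℝ] R n) :=
    (contDiffGroupoid ∞ 𝓘(ℝ, R n →L[ℝ] R n)).trans (leftMul g⁻¹).mem_contDiffGroupoid hc
  have he : ∀ h : GLR n, e h = c (g⁻¹ * h : GLR n) := fun h => rfl
  have hes : ∀ h : GLR n, h ∈ e.source ↔ ((g⁻¹ * h : GLR n) : R n →L[ℝ] R n) ∈ c.source := by
    intro h
    simp only [e, k, OpenPartialHomeomorph.trans_source, Units.chartAt_source, univ_inter,
      mem_preimage, mem_inter_iff]
    exact ⟨fun H => H.2, fun H => ⟨mem_univ _, H⟩⟩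
  refine ⟨e, W, StructureGroupoid.trans_mem_maximalAtlas
    (IsManifold.chart_mem_maximalAtlas g) hk, ?_, rfl, ?_⟩
  · rw [hes, inv_mul_cancel]
    exact h1
  · ext z
    constructor
    · rintro ⟨h, ⟨hh, hhG⟩, rfl⟩
      refine ⟨e.map_source hh, ?_⟩
      have : e h ∈ c '' (c.source ∩ (Units.val '' (G : Set (GLR n)))) :=
        ⟨_, ⟨(hes h).1 hh, _, G.mul_mem (G.inv_mem hg) hhG, rfl⟩, rfl⟩
      rw [himg] at this
      exact this.2
    · rintro ⟨hz, hzW⟩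
      have hz' : z ∈ c.target := hz.1.1
      have : z ∈ c '' (c.source ∩ (Units.val '' (G : Set (GLR n)))) := by
        rw [himg]
        exact ⟨hz', hzW⟩
      obtain ⟨_, ⟨hs, h, hhG, rfl⟩, rfl⟩ := this
      refine ⟨g * h, ⟨?_, G.mul_mem hg hhG⟩, ?_⟩
      · rwa [hes, inv_mul_cancel_left]
      · rw [he, inv_mul_cancel_left]

/-- Serves an empty `M`, where no base point supplies an isotropy group. -/
theorem isLieSubgroup_top : IsLieSubgroup (⊤ : Subgroup (GLR n)) := by
  refine ⟨Module.finrank ℝ (⊤ : Submodule ℝ (R n →L[ℝ] R n)), fun g _ =>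
    ⟨chartAt _ g, ⊤, IsManifold.chart_mem_maximalAtlas g, mem_chart_source _ g, rfl, ?_⟩⟩
  simp

/-! ### The local structure of the subgroupoid -/

/-- The criterion ignores the base coordinates of `q`; this is what later allows them to be
discarded when a retraction onto the group is built. -/
theorem ContainsSection.symm_jetChart_mem_iff (hΓ : IsReducedSubgroupoid Γ)
    {φ ψ : OpenPartialHomeomorph M (R n)} (h : ContainsSection Γ φ ψ) (hφ : φ ∈ smoothCharts n M)
    (hψ : ψ ∈ smoothCharts n M) {x : M} (hx : x ∈ φ.source) {q : JetModel n}
    (hq : q ∈ (jetChart φ ψ hφ hψ).target) :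
    (jetChart φ ψ hφ hψ).symm q ∈ Γ ↔
      q.2.2 ∈ Units.val '' (isotropyGroup hΓ x (frame φ x) : Set (GLR n)) := by
  have hs : (jetChart φ ψ hφ hψ).symm q ∈ (jetChart φ ψ hφ hψ).source :=
    (jetChart φ ψ hφ hψ).map_target hq
  have hv : (linearPart φ ψ ((jetChart φ ψ hφ hψ).symm q)).toUnit.val = q.2.2 :=
    congrArg (fun p : JetModel n => p.2.2) ((jetChart φ ψ hφ hψ).right_inv hq)
  rw [h.mem_iff hΓ hx hs.1 hs.2]
  constructor
  · exact fun H => ⟨_, H, hv⟩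
  · rintro ⟨A, hA, hAq⟩
    have : (linearPart φ ψ ((jetChart φ ψ hφ hψ).symm q)).toUnit = A := Units.ext (hv.trans hAq.symm)
    rwa [this]

/-- The isotropy groups of a reduced subgroupoid containing coordinate sections are embedded
submanifolds. -/
theorem ContainsSection.isLieSubgroup_isotropyGroup (hΓ : IsReducedSubgroupoid Γ)
    {φ ψ : OpenPartialHomeomorph M (R n)} (h : ContainsSection Γ φ ψ) (hφ : φ ∈ smoothCharts n M)
    (hψ : ψ ∈ smoothCharts n M) {x y : M} (hx : x ∈ φ.source) (hy : y ∈ ψ.source) :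
    IsLieSubgroup (isotropyGroup hΓ x (frame φ x)) := by
  set G := isotropyGroup hΓ x (frame φ x) with hG
  set j := jetChart φ ψ hφ hψ with hj
  obtain ⟨d, hd, -⟩ := hΓ.submanifold
  let p : (R n →L[ℝ] R n) → JetModel n := fun A => (φ x, ψ y, A)
  have hp : ContDiff ℝ ∞ p := contDiff_const.prodMk (contDiff_const.prodMk contDiff_id)
  have hp1 : p 1 ∈ j.target := ⟨φ.map_source hx, ψ.map_source hy,
    ContinuousLinearMap.isInvertible_equiv (f := ContinuousLinearEquiv.refl ℝ (R n))⟩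
  have hp1Γ : j.symm (p 1) ∈ Γ :=
    (h.symm_jetChart_mem_iff hΓ hφ hψ hx hp1).2 ⟨1, G.one_mem, rfl⟩
  obtain ⟨c, W, hc⟩ := hd _ hp1Γ
  let k := j.symm.trans c
  have hk : k ∈ contDiffGroupoid ∞ 𝓘(ℝ, JetModel n) :=
    StructureGroupoid.compatible_of_mem_maximalAtlas
      (IsManifold.subset_maximalAtlas (jetChart_mem_atlas hφ hψ)) hc.mem_maximalAtlas
  have hkd : ContDiffOn ℝ ∞ k k.source :=
    contMDiffOn_iff_contDiffOn.1 (contMDiffOn_of_mem_contDiffGroupoid hk)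
  have hkd' : ContDiffOn ℝ ∞ k.symm k.target :=
    contMDiffOn_iff_contDiffOn.1 (contMDiffOn_of_mem_contDiffGroupoid
      ((contDiffGroupoid ∞ 𝓘(ℝ, JetModel n)).symm hk))
  have hkW : ∀ q ∈ k.source, k q ∈ W ↔ q.2.2 ∈ Units.val '' (G : Set (GLR n)) := by
    intro q hq
    rw [← h.symm_jetChart_mem_iff hΓ hφ hψ hx hq.1]
    constructor
    · intro hqW
      have : k q ∈ c '' (c.source ∩ Γ) := by
        rw [hc.image_eq]
        exact ⟨c.map_source hq.2, hqW⟩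
      obtain ⟨g, ⟨hgs, hgΓ⟩, hgq⟩ := this
      rwa [c.injOn hgs hq.2 hgq] at hgΓ
    · intro hqΓ
      have : k q ∈ c '' (c.source ∩ Γ) := ⟨_, ⟨hq.2, hqΓ⟩, rfl⟩
      rw [hc.image_eq] at this
      exact this.2
  -- `π` is a linear projection of the model space onto `W`.
  obtain ⟨f, hf⟩ := LinearMap.exists_leftInverse_of_injective W.subtype W.ker_subtype
  let π : JetModel n →L[ℝ] JetModel n := LinearMap.toContinuousLinearMap (W.subtype ∘ₗ f)
  have hπW : ∀ w, π w ∈ W := fun w => (f w).2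
  have hπ : ∀ w ∈ W, π w = w := fun w hw =>
    congrArg Subtype.val (congrArg (fun A : W →ₗ[ℝ] W => A ⟨w, hw⟩) hf)
  have hO1 : IsOpen (p ⁻¹' k.source) := k.open_source.preimage hp.continuous
  have hkp : ContDiffOn ℝ ∞ (fun A => π (k (p A))) (p ⁻¹' k.source) :=
    π.contDiff.comp_contDiffOn (hkd.comp hp.contDiffOn fun _ hA => hA)
  have hN := hkp.continuousOn.isOpen_inter_preimage hO1 k.open_target
  have h1 : p 1 ∈ k.source := ⟨hp1, hc.mem_source⟩
  have hret : ∀ A, p A ∈ k.source → A ∈ Units.val '' (G : Set (GLR n)) →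
      π (k (p A)) = k (p A) := fun A hA hAG => hπ _ ((hkW _ hA).2 hAG)
  have h1G : (1 : R n →L[ℝ] R n) ∈ Units.val '' (G : Set (GLR n)) := ⟨1, G.one_mem, rfl⟩
  -- The retraction straightens `p A`, projects to `W`, returns and keeps the matrix part. The base
  -- coordinates may move on the way, but the matrix still lands in `G` by `hkW`; for `A` in `G`
  -- nothing moves.
  obtain ⟨c', W', hc', h1c', himg⟩ := exists_straightening_of_retraction
    (S := Units.val '' (G : Set (GLR n))) (s := 1) (r := fun A => (k.symm (π (k (p A)))).2.2)
    hN ⟨h1, by rw [mem_preimage, hret 1 h1 h1G]; exact k.map_source h1⟩ h1G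
    ((contDiff_snd.comp contDiff_snd).comp_contDiffOn
      (hkd'.comp (hkp.mono inter_subset_left) fun A hA => hA.2))
    (fun A hA => (hkW _ (k.map_target hA.2)).1 (by rw [k.right_inv hA.2]; exact hπW _))
    (fun A hA hAG => by rw [hret A hA.1 hAG, k.left_inv hA.1])
  exact isLieSubgroup_of_straightening hc' h1c' himg

/-- In charts whose coordinate section lies in `Γ`, the subgroupoid `Γ` is diffeomorphic to a
product. -/
theorem ContainsSection.isDiffeoBetween (hΓ : IsReducedSubgroupoid Γ)
    {φ ψ : OpenPartialHomeomorph M (R n)} (h : ContainsSection Γ φ ψ) (hφ : φ ∈ smoothCharts n M)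
    (hψ : ψ ∈ smoothCharts n M) {x : M} (hx : x ∈ φ.source) :
    IsDiffeoBetween 𝓘(ℝ, JetModel n)
      (𝓘(ℝ, R n).prod (𝓘(ℝ, R n).prod 𝓘(ℝ, R n →L[ℝ] R n)))
      (inducedMap φ ψ) (restrict Γ φ.source ψ.source)
      (φ.target ×ˢ (ψ.target ×ˢ (isotropyGroup hΓ x (frame φ x) : Set (GLR n)))) := by
  set G := isotropyGroup hΓ x (frame φ x) with hG
  set j := jetChart φ ψ hφ hψ with hj
  have hjm : j ∈ IsManifold.maximalAtlas 𝓘(ℝ, JetModel n) ∞ (Jet n M) :=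
    IsManifold.subset_maximalAtlas (jetChart_mem_atlas hφ hψ)
  -- Since `inducedMap φ ψ` followed by `ι` is the jet chart `j`, its inverse is `j.symm ∘ ι`.
  let ι : R n × R n × GLR n → JetModel n := fun q => (q.1, q.2.1, q.2.2.val)
  have hιj : ∀ g, ι (inducedMap φ ψ g) = j g := fun g => rfl
  have hι : Function.Injective ι := by
    rintro ⟨a, b, A⟩ ⟨a', b', A'⟩ hq
    simp only [ι, Prod.mk.injEq] at hq
    obtain ⟨rfl, rfl, hA⟩ := hq
    rw [Units.ext hA]
  have hsub : restrict Γ φ.source ψ.source ⊆ j.source := fun g hg => hg.2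
  have hmaps : MapsTo (inducedMap φ ψ) (restrict Γ φ.source ψ.source)
      (φ.target ×ˢ (ψ.target ×ˢ (G : Set (GLR n)))) := fun g hg =>
    ⟨φ.map_source hg.2.1, ψ.map_source hg.2.2, (h.mem_iff hΓ hx hg.2.1 hg.2.2).1 hg.1⟩
  have htarget : ∀ q ∈ φ.target ×ˢ (ψ.target ×ˢ (G : Set (GLR n))), ι q ∈ j.target :=
    fun q hq => ⟨hq.1, hq.2.1,
      ContinuousLinearMap.isInvertible_equiv (f := ContinuousLinearEquiv.ofUnit q.2.2)⟩
  have hmaps' : MapsTo (fun q => j.symm (ι q)) (φ.target ×ˢ (ψ.target ×ˢ (G : Set (GLR n))))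
      (restrict Γ φ.source ψ.source) := fun q hq =>
    ⟨(h.symm_jetChart_mem_iff hΓ hφ hψ hx (htarget q hq)).2 ⟨_, hq.2.2, rfl⟩,
      j.map_target (htarget q hq)⟩
  have hinv : InvOn (fun q => j.symm (ι q)) (inducedMap φ ψ) (restrict Γ φ.source ψ.source)
      (φ.target ×ˢ (ψ.target ×ˢ (G : Set (GLR n)))) :=
    ⟨fun g hg => j.left_inv (hsub hg), fun q hq => hι (j.right_inv (htarget q hq))⟩
  have hjs : ContMDiffOn 𝓘(ℝ, JetModel n) 𝓘(ℝ, JetModel n) ∞ j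
      (restrict Γ φ.source ψ.source) := (contMDiffOn_of_mem_maximalAtlas hjm).mono hsub
  refine ⟨hinv.bijOn hmaps hmaps', ?_, _, hinv, ?_⟩
  · have h1 : ContMDiff 𝓘(ℝ, JetModel n) 𝓘(ℝ, R n) ∞ (fun p : JetModel n => p.1) :=
      contDiff_fst.contMDiff
    have h2 : ContMDiff 𝓘(ℝ, JetModel n) 𝓘(ℝ, R n) ∞ (fun p : JetModel n => p.2.1) :=
      (contDiff_fst.comp contDiff_snd).contMDiff
    have h3 : ContMDiff 𝓘(ℝ, JetModel n) 𝓘(ℝ, R n →L[ℝ] R n) ∞ (fun p : JetModel n => p.2.2) :=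
      (contDiff_snd.comp contDiff_snd).contMDiff
    refine (h1.comp_contMDiffOn hjs).prodMk ((h2.comp_contMDiffOn hjs).prodMk ?_)
    -- Smoothness into the unit group comes from its chart, whose source is the whole group.
    have h4 : ContMDiffOn 𝓘(ℝ, R n →L[ℝ] R n) 𝓘(ℝ, R n →L[ℝ] R n) ∞
        (chartAt (R n →L[ℝ] R n) (1 : GLR n)).symm (chartAt (R n →L[ℝ] R n) (1 : GLR n)).target :=
      contMDiffOn_chart_symm
    have hs : ∀ A : GLR n, A ∈ (chartAt (R n →L[ℝ] R n) (1 : GLR n)).source := fun A => by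
      rw [Units.chartAt_source]
      exact mem_univ A
    refine (h4.comp (h3.comp_contMDiffOn hjs) fun g _ =>
      (chartAt (R n →L[ℝ] R n) (1 : GLR n)).map_source (hs (linearPart φ ψ g).toUnit)).congr
        fun g _ => ?_
    exact ((chartAt (R n →L[ℝ] R n) (1 : GLR n)).left_inv (hs (linearPart φ ψ g).toUnit)).symm
  · have hιm : ContMDiff (𝓘(ℝ, R n).prod (𝓘(ℝ, R n).prod 𝓘(ℝ, R n →L[ℝ] R n)))
        𝓘(ℝ, JetModel n) ∞ ι :=
      contMDiff_fst.prodMk_space ((contMDiff_fst.comp contMDiff_snd).prodMk_space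
        (Units.contMDiff_val.comp (contMDiff_snd.comp contMDiff_snd)))
    exact (contMDiffOn_symm_of_mem_maximalAtlas hjm).comp hιm.contMDiffOn htarget

end JetGroupoid

end

/-! ### The equivalence -/

open JetGroupoid in
theorem proposition63 (n : ℕ) (M : Type*) [TopologicalSpace M] [ChartedSpace (R n) M]
    [IsManifold 𝓘(ℝ, R n) ∞ M] (Γ : Set (Jet n M)) (hΓ : IsReducedSubgroupoid Γ) :
    IsIntegrable Γ ↔
      ∀ x y : M, ∃ (φ ψ : OpenPartialHomeomorph M (R n)) (hφ : φ ∈ smoothCharts n M)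
        (hψ : ψ ∈ smoothCharts n M), x ∈ φ.source ∧ y ∈ ψ.source ∧
          ∀ a ∈ φ.target, ∀ b ∈ ψ.target, coordinateSection φ ψ hφ hψ a b ∈ Γ := by
  constructor
  · rintro ⟨G, -, hG⟩ x y
    obtain ⟨φ, hφ, ψ, hψ, hx, hy, hdiffeo⟩ := hG x y
    refine ⟨φ, ψ, hφ, hψ, hx, hy, fun a ha b hb => ?_⟩
    obtain ⟨g, hg, hgq⟩ := hdiffeo.1.surjOn (show (a, b, 1) ∈ _ from ⟨ha, hb, G.one_mem⟩)
    -- The jet chart has the same components as `inducedMap`, so the preimage `g` of `(a, b, 1)` is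
    -- the section's value.
    have hgj : jetChart φ ψ hφ hψ g = (a, b, ContinuousLinearMap.id ℝ (R n)) :=
      congrArg (fun q : R n × R n × GLR n => (q.1, q.2.1, q.2.2.val)) hgq
    have hgs : (jetChart φ ψ hφ hψ).symm (jetChart φ ψ hφ hψ g) = g :=
      (jetChart φ ψ hφ hψ).left_inv hg.2
    rw [coordinateSection, ← hgj, hgs]
    exact hg.1
  · intro H
    rcases isEmpty_or_nonempty M with hM | ⟨⟨z⟩⟩
    · exact ⟨⊤, isLieSubgroup_top, fun x => hM.elim x⟩
    · obtain ⟨φ₀, ψ₀, hφ₀, hψ₀, hz, hz', hP₀⟩ := H z z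
      refine ⟨isotropyGroup hΓ z (frame φ₀ z), ((containsSection_iff hφ₀ hψ₀).2
        hP₀).isLieSubgroup_isotropyGroup hΓ hφ₀ hψ₀ hz hz', fun x y => ?_⟩
      obtain ⟨φ, ψ, hφ, hψ, hx, hy, hP⟩ := H x y
      obtain ⟨⟨_, _, T⟩, hT, rfl, rfl⟩ := hΓ.transitive z x
      dsimp only at *
      -- Chosen so that the changed frame at `x` is the frame of `φ₀` at `z` carried along `T`; the
      -- isotropy group at `x` then equals the one fixed at `z`.
      let C : R n ≃L[ℝ] R n := (frame φ _).symm.trans (T.symm.trans (frame φ₀ _))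
      have hC := (((containsSection_iff hφ hψ).2 hP).linearChange hφ hψ C).isDiffeoBetween hΓ
        (linearChange_mem hφ C) (linearChange_mem hψ C) (by rwa [linearChange_source])
      have hf : (frame φ _).trans C = T.symm.trans (frame φ₀ _) := by
        ext w
        simp [C]
      rw [frame_linearChange hφ C hx, hf, isotropyGroup_transport hΓ hT] at hC
      exact ⟨_, linearChange_mem hφ C, _, linearChange_mem hψ C,
        by rwa [linearChange_source], by rwa [linearChange_source], hC⟩
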